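/- **Definitions.** All rings are commutative with $1$. A difference field $(k,\sigma)$ is a field $k$ with a ring endomorphism $\sigma\colon k\to k$. A difference $k$-algebra $(A,\sigma_A)$ is a $k$-algebra $A$ with a ring endomorphism $\sigma_A$ such that $\sigma_A(r\cdot 1_A)=\sigma(r)\cdot 1_A$ for all $r\in k$. A cocorrespondence $A_0\xrightarrow{p}C_0\xleftarrow{s}A_0$ over $(k,\sigma)$ consists of $k$-algebras $A_0,C_0$, a $k$-algebra homomorphism $p$ and a ring homomorphism $s$ with $s(r\cdot 1_{A_0})=\sigma(r)\cdot 1_{C_0}$ for all $r\in k$. The difference $k$-algebra $[A_0;C_0]^k$ directly presented by it is the universal difference $k$-algebra with a $k$-algebra homomorphism $\eta\colon C_0\to[A_0;C_0]^k$ such that $\eta\circ s=\sigma_{[A_0;C_0]^k}\circ\eta\circ p$. In other words, it is the value at the given cocorrespondence of the left adjoint of the functor sending $(B,\sigma_B)$ to $B\xrightarrow{\mathrm{id}}B\xleftarrow{\sigma_B}B$. Explicitly, it is generated as a $k$-algebra by symbols $\sigma^n(c)$ ($n\ge 0$, $c\in C_0$), subject to the relations that each $c\mapsto\sigma^n(c)$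 is a ring homomorphism lying over $\sigma^n\colon k\to k$ and that $\sigma^n(s(a))=\sigma^{n+1}(p(a))$ for all $n\ge 0$ and $a\in A_0$; its difference operator sends $\sigma^n(c)$ to $\sigma^{n+1}(c)$. A difference $k$-algebra is finitely $\sigma$-presented étale if it is isomorphic, as a difference $k$-algebra, to $[A_0;C_0]^k$ for some cocorrespondence of étale $k$-algebras $A_0$, $C_0$ (over a field, étale means a finite product of finite separable field extensions). For a topological space $X$ with a continuous self-map $f$, the $\sigma$-topology on $X$ is the topology whose closed sets are the closed sets $F\subseteq X$ with $f(F)\subseteq F$, and the $\sigma$-connected components of $X$ are the connected components of $X$ in the $\sigma$-topology. **Proposition.** Let $(A,\sigma_A)$ be a finitely $\sigma$-presented étale difference algebra over a difference field $(k,\sigma)$. Then $\operatorname{Spec}(A)$, with its Zariski topology and the self-map $\mathfrak p\mapsto\sigma_A^{-1}(\mathfrak p)$, has finitely many $\sigma$-connected components. -/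

import Mathlib

universe u v w

/-! A difference ring is a commutative ring with a ring endomorphism; it is given here by the ring
together with the endomorphism.  For a difference ring `(k, σ)`, a difference `k`-algebra is a
`k`-algebra `A` with a ring endomorphism `σA` extending `σ`. -/

namespace DifferenceAlgebra

/-- `(A, σA)` is a difference algebra over the difference ring `(k, σ)`: the structure map
`k → A` commutes with the difference operators. -/
def IsDifferenceAlgebra {k : Type u} [CommRing k] (σ : k →+* k)
    {A : Type v} [CommRing A] [Algebra k A] (σA : A →+* A) : Prop :=
  ∀ r : k, σA (algebraMap k A r) = algebraMap k A (σ r)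

/-- A cocorrespondence `A₀ → C₀ ← A₀` over the difference ring `(k, σ)`: the first arrow `p` is
`k`-linear, and the second arrow `s` is a ring homomorphism lying over `σ : k → k`. -/
structure Cocorrespondence {k : Type u} [CommRing k] (σ : k →+* k) (A₀ C₀ : Type v)
    [CommRing A₀] [Algebra k A₀] [CommRing C₀] [Algebra k C₀] where
  p : A₀ →ₐ[k] C₀
  s : A₀ →+* C₀
  s_algebraMap : ∀ r : k, s (algebraMap k A₀ r) = algebraMap k C₀ (σ r)

section DirectPresentation

variable {k : Type u} [CommRing k] {σ : k →+* k} {A₀ C₀ : Type v}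
  [CommRing A₀] [Algebra k A₀] [CommRing C₀] [Algebra k C₀]

open MvPolynomial

/-- The relators of the difference algebra directly presented by a cocorrespondence.  The variable
`X (n, c)` stands for `σⁿ(c)`, for `c` in `C₀`.  The first three families make `c ↦ X (n, c)` a ring
homomorphism over `σⁿ : k → k`; the last one identifies `σⁿ(s a)` with `σⁿ⁺¹(p a)`. -/
inductive IsRelator (D : Cocorrespondence σ A₀ C₀) : MvPolynomial (ℕ × C₀) k → Prop
  | scalar (n : ℕ) (r : k) : IsRelator D (X (n, algebraMap k C₀ r) - C (σ^[n] r))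
  | add (n : ℕ) (c d : C₀) : IsRelator D (X (n, c + d) - (X (n, c) + X (n, d)))
  | mul (n : ℕ) (c d : C₀) : IsRelator D (X (n, c * d) - X (n, c) * X (n, d))
  | glue (n : ℕ) (a : A₀) : IsRelator D (X (n, D.s a) - X (n + 1, D.p a))

/-- The ideal generated by the relators. -/
noncomputable def relatorIdeal (D : Cocorrespondence σ A₀ C₀) : Ideal (MvPolynomial (ℕ × C₀) k) :=
  Ideal.span {f | IsRelator D f}

/-- The difference operator of the polynomial ring: `σ` on coefficients and `X (n, c) ↦ X (n+1, c)`
on variables. -/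
noncomputable def polyShift (σ : k →+* k) (C₀ : Type v) :
    MvPolynomial (ℕ × C₀) k →+* MvPolynomial (ℕ × C₀) k :=
  eval₂Hom (C.comp σ) (fun q => X (q.1 + 1, q.2))

theorem relatorIdeal_le_comap (D : Cocorrespondence σ A₀ C₀) :
    relatorIdeal D ≤ (relatorIdeal D).comap (polyShift σ C₀) := by
  refine Ideal.span_le.2 fun f hf => ?_
  refine Ideal.subset_span (?_ : IsRelator D (polyShift σ C₀ f))
  have h : IsRelator D f := hf
  cases h with
  | scalar n r =>
    have := IsRelator.scalar (D := D) (n + 1) r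
    rw [Function.iterate_succ_apply'] at this
    simpa [polyShift] using this
  | add n c d => simpa [polyShift] using IsRelator.add (D := D) (n + 1) c d
  | mul n c d => simpa [polyShift] using IsRelator.mul (D := D) (n + 1) c d
  | glue n a => simpa [polyShift] using IsRelator.glue (D := D) (n + 1) a

/-- The `k`-algebra underlying the difference `k`-algebra `[A₀; C₀]` directly presented by a
cocorrespondence. -/
abbrev DirectPresentation (D : Cocorrespondence σ A₀ C₀) : Type (max u v) :=
  MvPolynomial (ℕ × C₀) k ⧸ relatorIdeal D

/-- The difference operator of `[A₀; C₀]`, induced by `σⁿ(c) ↦ σⁿ⁺¹(c)`. -/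
noncomputable def DirectPresentation.shift (D : Cocorrespondence σ A₀ C₀) :
    DirectPresentation D →+* DirectPresentation D :=
  Ideal.quotientMap (relatorIdeal D) (polyShift σ C₀) (relatorIdeal_le_comap D)

theorem DirectPresentation.shift_mk (D : Cocorrespondence σ A₀ C₀)
    (f : MvPolynomial (ℕ × C₀) k) :
    DirectPresentation.shift D (Ideal.Quotient.mk _ f) =
      Ideal.Quotient.mk (relatorIdeal D) (polyShift σ C₀ f) :=
  Ideal.quotientMap_mk

theorem DirectPresentation.isDifferenceAlgebra (D : Cocorrespondence σ A₀ C₀) :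
    IsDifferenceAlgebra σ (DirectPresentation.shift D) := by
  intro r
  change DirectPresentation.shift D (Ideal.Quotient.mk _ (C r)) = Ideal.Quotient.mk _ (C (σ r))
  rw [DirectPresentation.shift_mk]
  simp [polyShift]

theorem DirectPresentation.mk_eq {D : Cocorrespondence σ A₀ C₀}
    {f g : MvPolynomial (ℕ × C₀) k} (h : IsRelator D (f - g)) :
    Ideal.Quotient.mk (relatorIdeal D) f = Ideal.Quotient.mk (relatorIdeal D) g :=
  Ideal.Quotient.eq.2 (Ideal.subset_span h)

/-- The canonical map `C₀ → [A₀; C₀]`. -/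
noncomputable def DirectPresentation.unit (D : Cocorrespondence σ A₀ C₀) :
    C₀ →ₐ[k] DirectPresentation D where
  toFun c := Ideal.Quotient.mk (relatorIdeal D) (X (0, c))
  map_one' := by
    have h := DirectPresentation.mk_eq (IsRelator.scalar (D := D) 0 1)
    simpa using h
  map_zero' := by
    have h := DirectPresentation.mk_eq (IsRelator.scalar (D := D) 0 0)
    simpa using h
  map_add' c d := by
    have h := DirectPresentation.mk_eq (IsRelator.add (D := D) 0 c d)
    simpa only [map_add] using h
  map_mul' c d := by
    have h := DirectPresentation.mk_eq (IsRelator.mul (D := D) 0 c d)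
    simpa only [map_mul] using h
  commutes' r := DirectPresentation.mk_eq (IsRelator.scalar (D := D) 0 r)

theorem DirectPresentation.unit_s (D : Cocorrespondence σ A₀ C₀) (a : A₀) :
    DirectPresentation.unit D (D.s a) =
      DirectPresentation.shift D (DirectPresentation.unit D (D.p a)) := by
  change Ideal.Quotient.mk _ (X (0, D.s a)) =
    DirectPresentation.shift D (Ideal.Quotient.mk _ (X (0, D.p a)))
  rw [DirectPresentation.shift_mk, DirectPresentation.mk_eq (IsRelator.glue (D := D) 0 a)]
  simp [polyShift]

/-- The universal property: morphisms of difference `k`-algebras from `[A₀; C₀]` to `(B, σB)`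
correspond to morphisms from `A₀ → C₀ ← A₀` to the cocorrespondence `B → B ← B` with arrows
`id` and `σB`, that is, to `k`-algebra homomorphisms `g : C₀ → B` with `g ∘ s = σB ∘ g ∘ p`. Thus
`[A₀; C₀]` is the value of the left adjoint of the forgetful functor from difference `k`-algebras
to cocorrespondences. -/
theorem DirectPresentation.existsUnique_lift (D : Cocorrespondence σ A₀ C₀)
    {B : Type w} [CommRing B] [Algebra k B] (σB : B →+* B) (hB : IsDifferenceAlgebra σ σB)
    (g : C₀ →ₐ[k] B) (hg : ∀ a : A₀, g (D.s a) = σB (g (D.p a))) :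
    ∃! φ : DirectPresentation D →ₐ[k] B,
      (∀ x, φ (DirectPresentation.shift D x) = σB (φ x)) ∧
        ∀ c, φ (DirectPresentation.unit D c) = g c := by
  have hB' : ∀ (n : ℕ) (r : k), σB^[n] (algebraMap k B r) = algebraMap k B (σ^[n] r) := by
    intro n r
    induction n with
    | zero => rfl
    | succ n ih => rw [Function.iterate_succ_apply', Function.iterate_succ_apply', ih, hB]
  let ψ : MvPolynomial (ℕ × C₀) k →ₐ[k] B := aeval (fun q => σB^[q.1] (g q.2))
  have hψ : ∀ f ∈ relatorIdeal D, ψ f = 0 := by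
    have : relatorIdeal D ≤ RingHom.ker ψ.toRingHom := by
      refine Ideal.span_le.2 fun f hf => ?_
      have h : IsRelator D f := hf
      change ψ f = 0
      cases h with
      | scalar n r => simp [ψ, hB', ← algebraMap_eq]
      | add n c d => simp [ψ, iterate_map_add]
      | mul n c d => simp [ψ, iterate_map_mul]
      | glue n a => simp [ψ, hg]
    exact fun f hf => this hf
  refine ⟨Ideal.Quotient.liftₐ _ ψ hψ, ⟨?_, ?_⟩, ?_⟩
  · intro x
    obtain ⟨f, rfl⟩ := Ideal.Quotient.mk_surjective x
    rw [DirectPresentation.shift_mk]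
    change ψ (polyShift σ C₀ f) = σB (ψ f)
    have : (ψ : _ →+* B).comp (polyShift σ C₀) = σB.comp (ψ : _ →+* B) := by
      refine MvPolynomial.ringHom_ext (fun r => ?_) (fun q => ?_)
      · change ψ (polyShift σ C₀ (C r)) = σB (ψ (C r))
        have h : polyShift σ C₀ (C r) = C (σ r) := by simp [polyShift]
        rw [h]
        change aeval _ (C (σ r)) = σB (aeval _ (C r))
        rw [aeval_C, aeval_C, hB r]
      · simp [ψ, polyShift, ← Function.iterate_succ_apply']
    exact congrArg (fun h : _ →+* B => h f) this
  · intro c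
    change ψ (X (0, c)) = g c
    simp [ψ]
  · rintro φ ⟨h1, h2⟩
    refine Ideal.Quotient.algHom_ext _ (MvPolynomial.algHom_ext fun q => ?_)
    obtain ⟨n, c⟩ := q
    change φ (Ideal.Quotient.mk _ (X (n, c))) = ψ (X (n, c))
    induction n with
    | zero =>
      have h : ψ (X (0, c)) = g c := by simp [ψ]
      rw [h]
      exact h2 c
    | succ n ih =>
      have : Ideal.Quotient.mk (relatorIdeal D) (X (n + 1, c)) =
          DirectPresentation.shift D (Ideal.Quotient.mk _ (X (n, c))) := by
        rw [DirectPresentation.shift_mk]; simp [polyShift]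
      rw [this, h1, ih]
      simp only [ψ, aeval_X, Function.iterate_succ_apply']

end DirectPresentation

/-- `(A, σA)` is finitely `σ`-presented étale over the difference field `(k, σ)`: it is isomorphic,
as a difference `k`-algebra, to `[A₀; C₀]` for a cocorrespondence `A₀ → C₀ ← A₀` of étale
`k`-algebras.  (Étale algebras over a field are finite-dimensional, so there is no loss in taking
`A₀` and `C₀` in the universe of `k`.) -/
def IsFinitelyPresentedEtale {k : Type u} [Field k] (σ : k →+* k)
    {A : Type v} [CommRing A] [Algebra k A] (σA : A →+* A) : Prop :=
  ∃ (A₀ C₀ : Type u) (_ : CommRing A₀) (_ : Algebra k A₀) (_ : CommRing C₀) (_ : Algebra k C₀)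
    (_ : Algebra.Etale k A₀) (_ : Algebra.Etale k C₀) (D : Cocorrespondence σ A₀ C₀)
    (e : DirectPresentation D ≃ₐ[k] A),
    ∀ x, e (DirectPresentation.shift D x) = σA (e x)

/-- The `σ`-topology on a topological space `X` with a continuous self-map `f`: its closed sets are
the closed sets `F` of `X` that are stable under `f`, that is, `f(F) ⊆ F`. -/
@[reducible]
def sigmaTopology {X : Type u} [TopologicalSpace X] (f : C(X, X)) : TopologicalSpace X :=
  TopologicalSpace.ofClosed {F | IsClosed F ∧ Set.MapsTo f F F}
    ⟨isClosed_empty, Set.mapsTo_empty _ _⟩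
    (fun _ h => ⟨isClosed_sInter fun _ hF => (h hF).1,
      fun _ hx F hF => (h hF).2 (hx F hF)⟩)
    (fun _ hF _ hG => ⟨hF.1.union hG.1, hF.2.union_union hG.2⟩)

theorem isClosed_sigmaTopology_iff {X : Type u} [TopologicalSpace X] (f : C(X, X)) (F : Set X) :
    @IsClosed X (sigmaTopology f) F ↔ IsClosed F ∧ Set.MapsTo f F F := by
  rw [← @isOpen_compl_iff X F (sigmaTopology f)]
  change Fᶜᶜ ∈ {F : Set X | IsClosed F ∧ Set.MapsTo f F F} ↔ _
  rw [compl_compl]; rfl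

/-- The type of `σ`-connected components of `X`: the connected components for the
`σ`-topology. -/
def SigmaConnectedComponents {X : Type u} [TopologicalSpace X] (f : C(X, X)) : Type u :=
  @ConnectedComponents X (sigmaTopology f)

/-- The continuous self-map `𝔭 ↦ σA⁻¹(𝔭)` of the Zariski spectrum of `A`. -/
def specMap {A : Type v} [CommRing A] (σA : A →+* A) : C(PrimeSpectrum A, PrimeSpectrum A) :=
  ⟨PrimeSpectrum.comap σA, PrimeSpectrum.continuous_comap σA⟩

end DifferenceAlgebra

namespace DifferenceAlgebra

/-! ### Topologies whose closed sets are all stable under a self-map. -/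

section Topology

variable {X : Type u} [TopologicalSpace X]

/-! Extend `σ` to an endomorphism `τ` of an algebraic closure `Ω` of `k`. A geometric point of `[A₀;
C₀]` then amounts to an infinite path in the graph whose vertices are the geometric points of `C₀`,
finite in number because `C₀` is finite-dimensional. This makes the spectrum an equivariant quotient
of the path space with its shift (`surjective_specPath`, `semiconj_specPath`), and Zariski open
conditions see only finite initial segments (`exists_specPath_mem`).

In the `σ`-topology a point and its image share a component, so a path may be replaced by any of its
tails. By pigeonhole, some tail starts at a vertex `v` and returns to it infinitely often. The paths
with this property for a fixed `v` form an irreducible set (`isPreirreducible_recurrentAt`), since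
two of them can be spliced at `v`. Hence there are at most as many components as vertices. -/

theorem finite_connectedComponents_of_surjective {Y : Type v} [TopologicalSpace Y] {q : X → Y}
    (hq : Continuous q) (hsurj : Function.Surjective q) [Finite (ConnectedComponents X)] :
    Finite (ConnectedComponents Y) := by
  refine Finite.of_surjective hq.connectedComponentsMap fun y => ?_
  obtain ⟨y, rfl⟩ := ConnectedComponents.surjective_coe y
  obtain ⟨x, rfl⟩ := hsurj y
  exact ⟨ConnectedComponents.mk x, rfl⟩

variable {f : X → X}

theorem mem_of_iterate_mem_of_isOpen (hf : ∀ F, IsClosed F → Set.MapsTo f F F) {U : Set X}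
    (hU : IsOpen U) {x : X} {n : ℕ} (hx : f^[n] x ∈ U) : x ∈ U := by
  by_contra h
  exact (hf _ hU.isClosed_compl).iterate n h hx

/-- The closure of `{x}` is connected, and, being closed, it is stable under `f`, so it contains the
whole forward orbit of `x`. -/
theorem connectedComponent_iterate (hf : ∀ F, IsClosed F → Set.MapsTo f F F) (x : X) (n : ℕ) :
    connectedComponent (f^[n] x) = connectedComponent x := by
  have hx : x ∈ closure {x} := subset_closure (Set.mem_singleton x)
  exact (connectedComponent_eq (isPreconnected_singleton.closure.subset_connectedComponent hx
    ((hf _ isClosed_closure).iterate n hx))).symm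

end Topology

/-! ### Symbolic dynamics: one-sided shifts on finite graphs. -/

section PathSpace

variable {V : Type u}

/-- The space of infinite paths in the directed graph with vertex set `V` and edge relation `E`. -/
def PathSpace (E : V → V → Prop) : Type u :=
  {y : ℕ → V // ∀ n, E (y n) (y (n + 1))}

variable {E : V → V → Prop}

/-- The map forgetting the first vertex of an infinite path. -/
def PathSpace.shift (y : PathSpace E) : PathSpace E :=
  ⟨fun n => y.1 (n + 1), fun n => y.2 (n + 1)⟩

theorem PathSpace.shift_iterate_apply (y : PathSpace E) (n m : ℕ) :
    (PathSpace.shift^[n] y).1 m = y.1 (m + n) := by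
  induction n generalizing y with
  | zero => rfl
  | succ n ih =>
    rw [Function.iterate_succ_apply, ih]
    exact congrArg y.1 (by omega)

/-- The path following `y` for `n` steps and continuing along `z`. -/
def PathSpace.splice (y z : PathSpace E) (n : ℕ) (h : y.1 n = z.1 0) : PathSpace E :=
  ⟨fun i => if i < n then y.1 i else z.1 (i - n), fun i => by
    by_cases h₁ : i + 1 < n
    · simpa [h₁, Nat.lt_of_succ_lt h₁] using y.2 i
    · by_cases h₂ : i < n
      · obtain rfl : n = i + 1 := by omega
        simpa [← h] using y.2 i
      · have : i + 1 - n = (i - n) + 1 := by omega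
        simpa [h₁, h₂, this] using z.2 (i - n)⟩

theorem PathSpace.splice_apply_of_lt (y z : PathSpace E) {n : ℕ} (h : y.1 n = z.1 0) {i : ℕ}
    (hi : i < n) : (y.splice z n h).1 i = y.1 i :=
  if_pos hi

theorem PathSpace.splice_apply_add (y z : PathSpace E) {n : ℕ} (h : y.1 n = z.1 0) (i : ℕ) :
    (y.splice z n h).1 (i + n) = z.1 i := by
  simp [PathSpace.splice]

theorem PathSpace.shift_iterate_splice (y z : PathSpace E) {n : ℕ}
    (h : y.1 n = z.1 0) : PathSpace.shift^[n] (y.splice z n h) = z :=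
  Subtype.ext <| funext fun i => by
    rw [PathSpace.shift_iterate_apply, PathSpace.splice_apply_add]

/-- The infinite paths starting at `v` and returning to it infinitely often. -/
def PathSpace.recurrentAt (E : V → V → Prop) (v : V) : Set (PathSpace E) :=
  {y | y.1 0 = v ∧ ∀ m, ∃ n ≥ m, y.1 n = v}

theorem PathSpace.exists_iterate_mem_recurrentAt [Finite V]
    (y : PathSpace E) : ∃ v n, PathSpace.shift^[n] y ∈ PathSpace.recurrentAt E v := by
  obtain ⟨v, hv⟩ := Finite.exists_infinite_fiber y.1
  have hv' := Set.infinite_coe_iff.1 hv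
  obtain ⟨n, hn⟩ := hv'.nonempty
  refine ⟨v, n, ?_, fun m => ?_⟩
  · rw [PathSpace.shift_iterate_apply, Nat.zero_add]
    exact hn
  · obtain ⟨l, hl, hml⟩ := hv'.exists_gt (m + n)
    refine ⟨l - n, by omega, ?_⟩
    rw [PathSpace.shift_iterate_apply, Nat.sub_add_cancel (by omega)]
    exact hl

/-- Follow `y ∈ U` long enough to stay in `U`, wait for a return to `v`, then follow `y' ∈ U'`. A
shift of the spliced path is `y'`, and open sets are stable under preimage by the shift, so the path
lies in `U'` too. -/
theorem PathSpace.isPreirreducible_recurrentAt [TopologicalSpace (PathSpace E)]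
    (hs : ∀ F : Set (PathSpace E), IsClosed F → Set.MapsTo PathSpace.shift F F)
    (hT : ∀ (U : Set (PathSpace E)) (y), IsOpen U → y ∈ U →
      ∃ n, ∀ z : PathSpace E, (∀ i < n, z.1 i = y.1 i) → z ∈ U) (v : V) :
    IsPreirreducible (PathSpace.recurrentAt E v) := by
  rintro U U' hU hU' ⟨y, hy, hyU⟩ ⟨y', hy', hyU'⟩
  obtain ⟨m, hm⟩ := hT U y hU hyU
  -- Returning after time `m` preserves the segment that decides membership in `U`; it also gives `n
  -- > 0`, so the splice begins at `y.1 0`.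
  obtain ⟨n, hmn, hn⟩ := hy.2 (m + 1)
  have h : y.1 n = y'.1 0 := hn.trans hy'.1.symm
  refine ⟨y.splice y' n h, ⟨?_, fun j => ?_⟩, hm _ fun i hi => ?_, ?_⟩
  · rw [PathSpace.splice_apply_of_lt _ _ _ (by omega), hy.1]
  · obtain ⟨i, hi, hv⟩ := hy'.2 j
    exact ⟨i + n, by omega, by rw [PathSpace.splice_apply_add, hv]⟩
  · exact PathSpace.splice_apply_of_lt _ _ _ (by omega)
  · refine mem_of_iterate_mem_of_isOpen hs hU' (n := n) ?_
    rwa [PathSpace.shift_iterate_splice]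

theorem PathSpace.finite_connectedComponents [Finite V] [TopologicalSpace (PathSpace E)]
    (hs : ∀ F : Set (PathSpace E), IsClosed F → Set.MapsTo PathSpace.shift F F)
    (hT : ∀ (U : Set (PathSpace E)) (y), IsOpen U → y ∈ U →
      ∃ n, ∀ z : PathSpace E, (∀ i < n, z.1 i = y.1 i) → z ∈ U) :
    Finite (ConnectedComponents (PathSpace E)) := by
  choose v n h using PathSpace.exists_iterate_mem_recurrentAt (E := E)
  let rep : ConnectedComponents (PathSpace E) → PathSpace E :=
    Function.surjInv ConnectedComponents.surjective_coe
  -- A component is determined by the recurrent vertex chosen for its representative.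
  refine Finite.of_injective (fun c => v (rep c)) fun c d hcd => ?_
  have hcd : v (rep c) = v (rep d) := hcd
  have key : connectedComponent (rep c) = connectedComponent (rep d) := by
    rw [← connectedComponent_iterate hs (rep c) (n (rep c)),
      ← connectedComponent_iterate hs (rep d) (n (rep d))]
    refine connectedComponent_eq ((PathSpace.isPreirreducible_recurrentAt hs hT
      (v (rep c))).isPreconnected.subset_connectedComponent (h _) ?_)
    rw [hcd]
    exact h _
  rw [← Function.surjInv_eq ConnectedComponents.surjective_coe c,
    ← Function.surjInv_eq ConnectedComponents.surjective_coe d]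
  exact ConnectedComponents.coe_eq_coe.2 key

/-- A topological dynamical system covered by the one-sided shift on a finite directed graph has
finitely many `σ`-connected components. -/
theorem finite_sigmaConnectedComponents_of_pathSpace [Finite V] {X : Type v} [TopologicalSpace X]
    {f : C(X, X)} {q : PathSpace E → X} (hsurj : Function.Surjective q)
    (hshift : Function.Semiconj q PathSpace.shift f)
    (hq : ∀ (U : Set X) (y), IsOpen U → q y ∈ U →
      ∃ n, ∀ z : PathSpace E, (∀ i < n, z.1 i = y.1 i) → q z ∈ U) :
    Finite (SigmaConnectedComponents f) := by
  -- The path space carries the pullback of the `σ`-topology, not the product topology, so its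
  -- closed sets are shift-stable.
  let T : TopologicalSpace (PathSpace E) := (sigmaTopology f).induced q
  have hfin : Finite (ConnectedComponents (PathSpace E)) := by
    refine PathSpace.finite_connectedComponents (fun F hF => ?_) fun U y hU hy => ?_
    · obtain ⟨F, hF', rfl⟩ := (@isClosed_induced_iff _ _ (sigmaTopology f) _ _).1 hF
      intro y hy
      rw [Set.mem_preimage, hshift.eq]
      exact ((isClosed_sigmaTopology_iff f F).1 hF').2 hy
    · obtain ⟨U, hU', rfl⟩ := (@isOpen_induced_iff _ _ (sigmaTopology f) _ _).1 hU
      exact hq U y (isClosed_compl_iff.1 ((isClosed_sigmaTopology_iff f _).1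
        ((@isClosed_compl_iff X (sigmaTopology f) U).2 hU')).1) hy
  exact @finite_connectedComponents_of_surjective _ T _ (sigmaTopology f) q
    (@continuous_induced_dom _ _ q (sigmaTopology f)) hsurj hfin

end PathSpace

/-! ### Extending `σ` and lifting points to an algebraically closed field. -/

theorem IsDifferenceAlgebra.iterate {k : Type u} [CommRing k] {σ : k →+* k}
    {A : Type v} [CommRing A] [Algebra k A] {σA : A →+* A} (h : IsDifferenceAlgebra σ σA)
    (n : ℕ) (r : k) : σA^[n] (algebraMap k A r) = algebraMap k A (σ^[n] r) := by
  induction n with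
  | zero => rfl
  | succ n ih => rw [Function.iterate_succ_apply', Function.iterate_succ_apply', ih, h]

theorem IsDifferenceAlgebra.pow {k : Type u} [CommRing k] {σ : k →+* k}
    {A : Type v} [CommRing A] [Algebra k A] {σA : A →+* A} (h : IsDifferenceAlgebra σ σA)
    (n : ℕ) : IsDifferenceAlgebra (σ ^ n) (σA ^ n) := fun r => by
  simpa only [RingHom.coe_pow] using h.iterate n r

theorem IsDifferenceAlgebra.isIntegral {k : Type u} [CommRing k] {σ : k →+* k}
    {A : Type v} [CommRing A] [Algebra k A] {σA : A →+* A} (h : IsDifferenceAlgebra σ σA)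
    {x : A} (hx : IsIntegral k x) : IsIntegral k (σA x) :=
  hx.map_of_comp_eq σ σA (RingHom.ext fun r => (h r).symm)

theorem exists_isDifferenceAlgebra_of_isAlgClosed {k : Type u} [Field k] (σ : k →+* k)
    (Ω : Type v) [Field Ω] [Algebra k Ω] [Algebra.IsAlgebraic k Ω] [IsAlgClosed Ω] :
    ∃ τ : Ω →+* Ω, IsDifferenceAlgebra σ τ := by
  -- Stated for a general target `M`, so that the `σ`-twisted `k`-structure on `Ω` does not clash
  -- with the given one.
  have lift : ∀ {M : Type v} [Field M] [IsAlgClosed M] (f : k →+* M),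
      ∃ g : Ω →+* M, ∀ r, g (algebraMap k Ω r) = f r := by
    intro M _ _ f
    let := f.toAlgebra
    exact ⟨(IsAlgClosed.lift (R := k) (S := Ω) (M := M)).toRingHom,
      fun r => (IsAlgClosed.lift (R := k) (S := Ω) (M := M)).commutes r⟩
  exact lift ((algebraMap k Ω).comp σ)

/-- Ring homomorphisms lying over `ρ` from an integral algebra to an algebraically closed field
factor through any extension of `ρ` to that field. -/
theorem exists_algHom_comp_eq {k : Type u} [Field k] {ρ : k →+* k}
    {Ω : Type v} [Field Ω] [Algebra k Ω] [IsAlgClosed Ω] {τ : Ω →+* Ω}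
    (hτ : IsDifferenceAlgebra ρ τ) {B : Type w} [CommRing B] [Algebra k B]
    [Algebra.IsIntegral k B] (x : B →+* Ω)
    (hx : ∀ r, x (algebraMap k B r) = algebraMap k Ω (ρ r)) :
    ∃ y : B →ₐ[k] Ω, ∀ b, τ (y b) = x b := by
  have hmem : ∀ b, ∃ a, τ a = x b := by
    intro b
    obtain ⟨p, hp, hpb⟩ := Algebra.IsIntegral.isIntegral (R := k) b
    -- `x b` is a root of the image under `τ` of a polynomial that already splits in `Ω`, so it lies
    -- in the range of `τ`, even when `τ` is not surjective.
    refine (IsAlgClosed.splits (p.map (algebraMap k Ω))).mem_range_of_isRoot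
      (hp.map _).ne_zero (i := τ) ?_
    have hcomp : τ.comp (algebraMap k Ω) = x.comp (algebraMap k B) :=
      RingHom.ext fun r => (hτ r).trans (hx r).symm
    rw [Polynomial.map_map, hcomp, Polynomial.IsRoot, Polynomial.eval_map,
      ← Polynomial.hom_eval₂, hpb, map_zero]
  choose y hy using hmem
  refine ⟨⟨⟨⟨⟨y, ?_⟩, ?_⟩, ?_, ?_⟩, ?_⟩, hy⟩
  · exact τ.injective (by rw [hy, map_one, map_one])
  · exact fun a b => τ.injective (by simp only [hy, map_mul])
  · exact τ.injective (by simp only [hy, map_zero])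
  · exact fun a b => τ.injective (by simp only [hy, map_add])
  · exact fun r => τ.injective (by simp only [hy, hx, hτ r])

/-- The kernel of any such map meets the field `k` in zero, and in an integral domain extension an
ideal contracting to zero is zero. -/
theorem exists_injective_algHom {k : Type u} [Field k] (Ω : Type v) [Field Ω] [Algebra k Ω]
    [IsAlgClosed Ω] (B : Type w) [CommRing B] [IsDomain B] [Algebra k B] [Algebra.IsIntegral k B] :
    ∃ ψ : B →ₐ[k] Ω, Function.Injective ψ := by
  refine ⟨IsAlgClosed.lift, (RingHom.injective_iff_ker_eq_bot (IsAlgClosed.lift : B →ₐ[k] Ω)).2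
    (Ideal.eq_bot_of_comap_eq_bot (R := k) ?_)⟩
  refine (Submodule.eq_bot_iff _).2 fun r hr => (algebraMap k Ω).injective ?_
  rw [map_zero, ← AlgHom.commutes (IsAlgClosed.lift : B →ₐ[k] Ω)]
  exact hr

theorem exists_algHom_ker_eq {k : Type u} [Field k] (Ω : Type v) [Field Ω] [Algebra k Ω]
    [IsAlgClosed Ω] {B : Type w} [CommRing B] [Algebra k B] [Algebra.IsIntegral k B]
    (P : Ideal B) [P.IsPrime] : ∃ φ : B →ₐ[k] Ω, RingHom.ker φ = P := by
  obtain ⟨ψ, hψ⟩ := exists_injective_algHom (k := k) Ω (B ⧸ P)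
  exact ⟨ψ.comp (Ideal.Quotient.mkₐ k P), Ideal.ext fun x =>
    (map_eq_zero_iff ψ hψ).trans Ideal.Quotient.eq_zero_iff_mem⟩

/-! ### Geometric points of `[A₀; C₀]` as infinite paths. -/

section GeometricPoints

open MvPolynomial

variable {k : Type u} [Field k] {σ : k →+* k} {A₀ C₀ : Type v}
  [CommRing A₀] [Algebra k A₀] [CommRing C₀] [Algebra k C₀]

theorem DirectPresentation.shift_pow_unit (D : Cocorrespondence σ A₀ C₀) (n : ℕ) (c : C₀) :
    (DirectPresentation.shift D ^ n) (DirectPresentation.unit D c) =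
      Ideal.Quotient.mk (relatorIdeal D) (X (n, c)) := by
  induction n with
  | zero => rfl
  | succ n ih =>
    rw [pow_succ', RingHom.mul_def, RingHom.comp_apply, ih, DirectPresentation.shift_mk]
    simp [polyShift]

theorem DirectPresentation.isIntegral (D : Cocorrespondence σ A₀ C₀) [Algebra.IsIntegral k C₀] :
    Algebra.IsIntegral k (DirectPresentation D) where
  isIntegral x := by
    obtain ⟨f, rfl⟩ := Ideal.Quotient.mk_surjective x
    induction f using MvPolynomial.induction_on with
    | C r => exact isIntegral_algebraMap (R := k) (A := DirectPresentation D) (x := r)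
    | add f g hf hg => rw [map_add]; exact hf.add hg
    | mul_X f q hf =>
      obtain ⟨n, c⟩ := q
      rw [map_mul, ← DirectPresentation.shift_pow_unit]
      exact hf.mul (((DirectPresentation.isDifferenceAlgebra D).pow n).isIntegral
        ((Algebra.IsIntegral.isIntegral c).map (DirectPresentation.unit D)))

variable {Ω : Type w} [Field Ω] [Algebra k Ω]

/-- The edge relation of the directed graph on the geometric points of `C₀` determined by a
cocorrespondence. -/
def Cocorrespondence.Edge (D : Cocorrespondence σ A₀ C₀) (τ : Ω →+* Ω)
    (y z : C₀ →ₐ[k] Ω) : Prop :=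
  ∀ a, y (D.s a) = τ (z (D.p a))

/-- The geometric point of `[A₀; C₀]` determined by an infinite path `y₀, y₁, …` of geometric points
of `C₀`: it maps `σⁿ(c)` to `τⁿ(yₙ(c))`. -/
noncomputable def DirectPresentation.evalPath (D : Cocorrespondence σ A₀ C₀) {τ : Ω →+* Ω}
    (hτ : IsDifferenceAlgebra σ τ) (y : PathSpace (D.Edge τ)) : DirectPresentation D →ₐ[k] Ω :=
  Ideal.Quotient.liftₐ _ (aeval fun q : ℕ × C₀ => τ^[q.1] (y.1 q.1 q.2)) <| by
    have : relatorIdeal D ≤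
        RingHom.ker (aeval (R := k) fun q : ℕ × C₀ => τ^[q.1] (y.1 q.1 q.2)) := by
      refine Ideal.span_le.2 fun f hf => ?_
      have h : IsRelator D f := hf
      rw [SetLike.mem_coe, RingHom.mem_ker]
      cases h with
      | scalar n r => simp [hτ.iterate]
      | add n c d => simp [iterate_map_add]
      | mul n c d => simp [iterate_map_mul]
      | glue n a => simp [y.2 n a]
    exact fun f hf => this hf

theorem DirectPresentation.evalPath_mk_X (D : Cocorrespondence σ A₀ C₀) {τ : Ω →+* Ω}
    (hτ : IsDifferenceAlgebra σ τ) (y : PathSpace (D.Edge τ)) (n : ℕ) (c : C₀) :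
    DirectPresentation.evalPath D hτ y (Ideal.Quotient.mk _ (X (n, c))) = τ^[n] (y.1 n c) :=
  (Ideal.Quotient.lift_mk _ _ _).trans (aeval_X _ _)

theorem DirectPresentation.ringHom_ext {D : Cocorrespondence σ A₀ C₀}
    {B : Type*} [CommRing B] {f g : DirectPresentation D →+* B}
    (h : ∀ r, f (algebraMap k _ r) = g (algebraMap k _ r))
    (h' : ∀ n c, f (Ideal.Quotient.mk _ (X (n, c))) = g (Ideal.Quotient.mk _ (X (n, c)))) :
    f = g :=
  Ideal.Quotient.ringHom_ext (MvPolynomial.ringHom_ext h fun q => h' q.1 q.2)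

theorem DirectPresentation.evalPath_shift (D : Cocorrespondence σ A₀ C₀) {τ : Ω →+* Ω}
    (hτ : IsDifferenceAlgebra σ τ) (y : PathSpace (D.Edge τ)) (x : DirectPresentation D) :
    DirectPresentation.evalPath D hτ y (DirectPresentation.shift D x) =
      τ (DirectPresentation.evalPath D hτ y.shift x) := by
  have : (DirectPresentation.evalPath D hτ y : _ →+* Ω).comp (DirectPresentation.shift D) =
      τ.comp (DirectPresentation.evalPath D hτ y.shift : _ →+* Ω) := by
    refine DirectPresentation.ringHom_ext (fun r => ?_) fun n c => ?_
    · rw [RingHom.comp_apply, DirectPresentation.isDifferenceAlgebra D r]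
      simp [hτ r]
    · have h : polyShift σ C₀ (X (n, c)) = X (n + 1, c) := by simp [polyShift]
      simp only [RingHom.comp_apply, RingHom.coe_coe, DirectPresentation.shift_mk, h,
        DirectPresentation.evalPath_mk_X, Function.iterate_succ_apply']
      rfl
  exact RingHom.congr_fun this x

/-- An element is a polynomial in finitely many `σⁿ(c)`, and the value of `σⁿ(c)` depends only on
the `n`-th vertex. -/
theorem DirectPresentation.exists_evalPath_congr
    (D : Cocorrespondence σ A₀ C₀) {τ : Ω →+* Ω} (hτ : IsDifferenceAlgebra σ τ)
    (x : DirectPresentation D) :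
    ∃ n, ∀ y z : PathSpace (D.Edge τ), (∀ i < n, z.1 i = y.1 i) →
      DirectPresentation.evalPath D hτ z x = DirectPresentation.evalPath D hτ y x := by
  obtain ⟨f, rfl⟩ := Ideal.Quotient.mk_surjective x
  induction f using MvPolynomial.induction_on with
  | C r =>
    exact ⟨0, fun y z _ => ((DirectPresentation.evalPath D hτ z).commutes r).trans
      ((DirectPresentation.evalPath D hτ y).commutes r).symm⟩
  | add f g hf hg =>
    obtain ⟨m, hm⟩ := hf
    obtain ⟨n, hn⟩ := hg
    refine ⟨max m n, fun y z h => ?_⟩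
    simp only [map_add]
    rw [hm y z fun i hi => h i (by omega), hn y z fun i hi => h i (by omega)]
  | mul_X f q hf =>
    obtain ⟨m, hm⟩ := hf
    obtain ⟨n, c⟩ := q
    refine ⟨max m (n + 1), fun y z h => ?_⟩
    simp only [map_mul, DirectPresentation.evalPath_mk_X]
    rw [hm y z fun i hi => h i (by omega), h n (by omega)]

/-- The map sending an infinite path of geometric points of `C₀` to the corresponding point of the
spectrum of `[A₀; C₀]`. -/
noncomputable def DirectPresentation.specPath (D : Cocorrespondence σ A₀ C₀) {τ : Ω →+* Ω}
    (hτ : IsDifferenceAlgebra σ τ) (y : PathSpace (D.Edge τ)) :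
    PrimeSpectrum (DirectPresentation D) :=
  ⟨RingHom.ker (DirectPresentation.evalPath D hτ y), RingHom.ker_isPrime _⟩

theorem DirectPresentation.exists_specPath_mem
    (D : Cocorrespondence σ A₀ C₀) {τ : Ω →+* Ω} (hτ : IsDifferenceAlgebra σ τ)
    {U : Set (PrimeSpectrum (DirectPresentation D))} (hU : IsOpen U) {y : PathSpace (D.Edge τ)}
    (hy : DirectPresentation.specPath D hτ y ∈ U) :
    ∃ n, ∀ z : PathSpace (D.Edge τ), (∀ i < n, z.1 i = y.1 i) →
      DirectPresentation.specPath D hτ z ∈ U := by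
  obtain ⟨_, ⟨x, rfl⟩, hx, hsub⟩ :=
    PrimeSpectrum.isTopologicalBasis_basic_opens.exists_subset_of_mem_open hy hU
  obtain ⟨n, hn⟩ := DirectPresentation.exists_evalPath_congr D hτ x
  have hx : DirectPresentation.evalPath D hτ y x ≠ 0 := hx
  refine ⟨n, fun z hz => hsub ?_⟩
  change DirectPresentation.evalPath D hτ z x ≠ 0
  rwa [hn y z hz]

/-- The shift commutes with evaluation only up to `τ`, which is injective and so disappears on
kernels. -/
theorem DirectPresentation.semiconj_specPath
    (D : Cocorrespondence σ A₀ C₀) {τ : Ω →+* Ω} (hτ : IsDifferenceAlgebra σ τ) :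
    Function.Semiconj (DirectPresentation.specPath D hτ) (PathSpace.shift)
      (specMap (DirectPresentation.shift D)) := by
  intro y
  refine PrimeSpectrum.ext (Ideal.ext fun x => ?_)
  change DirectPresentation.evalPath D hτ _ x = 0 ↔
    DirectPresentation.evalPath D hτ y (DirectPresentation.shift D x) = 0
  rw [DirectPresentation.evalPath_shift, map_eq_zero τ]

theorem DirectPresentation.surjective_specPath [Algebra.IsIntegral k C₀] [IsAlgClosed Ω]
    (D : Cocorrespondence σ A₀ C₀) {τ : Ω →+* Ω} (hτ : IsDifferenceAlgebra σ τ) :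
    Function.Surjective (DirectPresentation.specPath D hτ) := by
  intro P
  have := DirectPresentation.isIntegral D
  obtain ⟨φ, hφ⟩ := exists_algHom_ker_eq (k := k) Ω P.asIdeal
  have hD := DirectPresentation.isDifferenceAlgebra D
  -- The map `c ↦ φ(σⁿ(c))` lies over `σⁿ`; untwisting it by `τ ^ n` gives the `n`-th vertex.
  -- Injectivity of `τ ^ n` then yields the edge condition from `σⁿ(s a) = σⁿ⁺¹(p a)`.
  have hy : ∀ n, ∃ y : C₀ →ₐ[k] Ω, ∀ c, (τ ^ n) (y c) =
      φ ((DirectPresentation.shift D ^ n) (DirectPresentation.unit D c)) := fun n =>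
    exists_algHom_comp_eq (hτ.pow n)
      (((φ : _ →+* Ω).comp (DirectPresentation.shift D ^ n)).comp
        (DirectPresentation.unit D : C₀ →+* DirectPresentation D)) fun r => by
      simp [hD.iterate n r]
  choose y hy using hy
  have hedge : ∀ n, D.Edge τ (y n) (y (n + 1)) := fun n a => by
    refine (τ ^ n).injective ?_
    rw [hy, DirectPresentation.unit_s, ← RingHom.comp_apply, ← RingHom.mul_def, ← pow_succ, ← hy,
      pow_succ]
    rfl
  let z : PathSpace (D.Edge τ) := ⟨y, hedge⟩
  have hz : (DirectPresentation.evalPath D hτ z : DirectPresentation D →+* Ω) =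
      (φ : DirectPresentation D →+* Ω) := by
    refine DirectPresentation.ringHom_ext (fun r => by simp) fun n c => ?_
    rw [RingHom.coe_coe, RingHom.coe_coe, DirectPresentation.evalPath_mk_X,
      ← DirectPresentation.shift_pow_unit, ← hy, RingHom.coe_pow]
  refine ⟨z, PrimeSpectrum.ext (Eq.trans (Ideal.ext fun x => ?_) hφ)⟩
  exact iff_of_eq (congrArg (· = 0) (RingHom.congr_fun hz x))

end GeometricPoints

/-! ### Conclusion: transport along the presentation. -/

theorem IsFinitelyPresentedEtale.finite_sigmaConnectedComponents {k : Type u} [Field k]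
    {σ : k →+* k} {A : Type v} [CommRing A] [Algebra k A] {σA : A →+* A}
    (hA : IsFinitelyPresentedEtale σ σA) : Finite (SigmaConnectedComponents (specMap σA)) := by
  obtain ⟨A₀, C₀, _, _, _, _, _, _, D, e, he⟩ := hA
  have : Module.Finite k C₀ := Algebra.FormallyUnramified.finite_of_free k C₀
  obtain ⟨τ, hτ⟩ := exists_isDifferenceAlgebra_of_isAlgClosed σ (AlgebraicClosure k)
  let φ := PrimeSpectrum.homeomorphOfRingEquiv e.toRingEquiv
  have hφ : Function.Semiconj φ (specMap (DirectPresentation.shift D)) (specMap σA) := fun P => by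
    refine PrimeSpectrum.ext (Ideal.ext fun x => ?_)
    change DirectPresentation.shift D (e.symm x) ∈ P.asIdeal ↔ e.symm (σA x) ∈ P.asIdeal
    rw [e.symm_apply_eq.2 (show σA x = e (DirectPresentation.shift D (e.symm x)) by
      rw [he, e.apply_symm_apply])]
  exact finite_sigmaConnectedComponents_of_pathSpace
    (φ.surjective.comp (DirectPresentation.surjective_specPath D hτ))
    (hφ.comp_left (DirectPresentation.semiconj_specPath D hτ)) fun U y hU hy =>
      DirectPresentation.exists_specPath_mem D hτ (hU.preimage φ.continuous) hy

end DifferenceAlgebra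

theorem proposition5p5 {k : Type u} [Field k] (σ : k →+* k)
    {A : Type v} [CommRing A] [Algebra k A] (σA : A →+* A)
    (hσA : DifferenceAlgebra.IsDifferenceAlgebra σ σA)
    (hA : DifferenceAlgebra.IsFinitelyPresentedEtale σ σA) :
    Finite (DifferenceAlgebra.SigmaConnectedComponents (DifferenceAlgebra.specMap σA)) := by
  exact hA.finite_sigmaConnectedComponents
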